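/- By a graph $\Gamma$ we mean a directed graph, possibly with loops and multiple edges, with vertex set $V_\Gamma$, edge set $E_\Gamma$, source and target maps $s,t:E_\Gamma\to V_\Gamma$ and a weight function $w:E_\Gamma\to\mathbb{Z}_{>0}$. For $x,y\in V_\Gamma$, let $d_\Gamma(x,y)\in\mathbb{Z}_{\ge 0}\cup\{\infty\}$ be the smallest total weight $\sum_j w(e_j)$ of a directed walk $e_1\cdots e_\ell$ from $x$ to $y$ (the trivial walk at $x$ has weight $0$, and $d_\Gamma(x,y)=\infty$ if there is no walk from $x$ to $y$). A periodic graph $(\Gamma,L)$ is a graph $\Gamma$ together with a free abelian group $L\simeq\mathbb{Z}^n$ of some finite rank $n\ge 1$ that acts freely on $V_\Gamma$ and on $E_\Gamma$, compatibly with $s$ and $t$ and preserving $w$, such that $V_\Gamma/L$ and $E_\Gamma/L$ are finite. Let $(\Gamma,L)$ be a periodic graph, let $x_0\in V_\Gamma$, let $L'<L$ be a subgroup, and let $V'\subset V_\Gamma$ be a finitely generated $L'$-submodule, i.e. a subset of the form $V'=L'+F=\{u+x \mid u\in L',\ x\in F\}$ for some finite set $F\subset V_\Gamma$. Then the set $\{y\in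 V' \mid d_\Gamma(x_0,y)\le i\}$ is finite for every $i\in\mathbb{Z}_{\ge 0}$, and the function \[ \mathbb{Z}_{\ge 0}\to\mathbb{Z}_{\ge 0};\quad i\mapsto \#\{y\in V' \mid d_\Gamma(x_0,y)\le i\} \] is of quasi-polynomial type: there exist integers $N\ge 1$ and $M\ge 0$ and polynomials $Q_0,\dots,Q_{N-1}\in\mathbb{C}[x]$ such that, for every integer $i>M$, the value of the function at $i$ equals $Q_j(i)$, where $j\in\{0,\dots,N-1\}$ and $i\equiv j\pmod N$. -/

import Mathlib

/-- A directed graph with positive integer edge weights, possibly with loops and multiple edges,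
with vertex set `V` and edge set `E`. -/
structure WeightedDigraph (V E : Type*) where
  /-- the source of an edge -/
  src : E → V
  /-- the target of an edge -/
  tgt : E → V
  /-- the weight of an edge -/
  weight : E → ℕ
  weight_pos : ∀ e, 0 < weight e

namespace WeightedDigraph

variable {V E : Type*}

/-- `Γ.IsWalk x p y`: the list `p` of consecutive edges is a walk from `x` to `y`.
The empty list is the trivial walk at `x`. -/
def IsWalk (Γ : WeightedDigraph V E) : V → List E → V → Prop
  | x, [], y => x = y
  | x, e :: p, y => Γ.src e = x ∧ Γ.IsWalk (Γ.tgt e) p y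

/-- The weight of a walk: the sum of the weights of its edges. -/
def walkWeight (Γ : WeightedDigraph V E) (p : List E) : ℕ := (p.map Γ.weight).sum

/-- The smallest weight of a walk from `x` to `y`; it is `⊤` if there is no such walk. -/
noncomputable def dist (Γ : WeightedDigraph V E) (x y : V) : ℕ∞ :=
  ⨅ (p : List E) (_ : Γ.IsWalk x p y), (Γ.walkWeight p : ℕ∞)

/-- `(Γ, L)` is an `n`-dimensional periodic graph, for given actions of `L` on the vertices and
on the edges. -/
structure IsPeriodic (Γ : WeightedDigraph V E) (L : Type*) [AddCommGroup L]
    [AddAction L V] [AddAction L E] (n : ℕ) : Prop where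
  dim_pos : 0 < n
  lattice : Nonempty (L ≃+ (Fin n → ℤ))
  free_vertices : ∀ (u : L) (x : V), u +ᵥ x = x → u = 0
  free_edges : ∀ (u : L) (e : E), u +ᵥ e = e → u = 0
  finite_vertices : Finite (AddAction.orbitRel.Quotient L V)
  finite_edges : Finite (AddAction.orbitRel.Quotient L E)
  src_vadd : ∀ (u : L) (e : E), Γ.src (u +ᵥ e) = u +ᵥ Γ.src e
  tgt_vadd : ∀ (u : L) (e : E), Γ.tgt (u +ᵥ e) = u +ᵥ Γ.tgt e
  weight_vadd : ∀ (u : L) (e : E), Γ.weight (u +ᵥ e) = Γ.weight e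

end WeightedDigraph

/-- A function `f : ℤ → ℂ` is a quasi-polynomial if for some `N > 0` it agrees with a polynomial
on each residue class modulo `N`. -/
def IsQuasiPolynomial (f : ℤ → ℂ) : Prop :=
  ∃ N : ℕ, 0 < N ∧ ∃ Q : Fin N → Polynomial ℂ,
    ∀ (m : ℤ) (i : Fin N), m ≡ (i : ℤ) [ZMOD N] → f m = (Q i).eval (m : ℂ)

/-- A function on the non-negative integers is of quasi-polynomial type if it agrees with a
quasi-polynomial at all sufficiently large integers. -/
def IsOfQuasiPolynomialType (g : ℕ → ℂ) : Prop :=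
  ∃ (M : ℕ) (f : ℤ → ℂ), IsQuasiPolynomial f ∧ ∀ m : ℕ, M < m → g m = f m

/-!
Fix a vertex `x`. A walk from `x₀` to a translate `u +ᵥ x` is recorded by its pair
(weight, `u`) in `ℕ × L`. By Kleene's algorithm on the finite quotient graph these pairs form a
semilinear set, and so do the pairs `(i, u)` with `dist x₀ (u +ᵥ x) ≤ i` and `u` in `L'`. As only
finitely many of them have a given `i`, the set is a finite union of finitely generated modules
over monoids of positive weight; these modules are stable under intersection, so by
inclusion-exclusion it suffices to count the elements of weight `i` in one of them. Choosing
lexicographically least representatives turns this into counting in the complement of an upper set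
of `ℕ ^ k`, and by Dickson's lemma into counting in orthants, where removing one generator of weight
`a` applies the difference operator of step `a` to the counting function. Functions built in this
way are annihilated by some `X ^ M * (X ^ N - 1) ^ d` in the shift, that is, they are eventually
quasi-polynomial.
-/

open Polynomial Set fwdDiff_aux
open scoped Pointwise fwdDiff

section Sequences

theorem X_pow_sub_one_mul_dvd {R : Type*} [CommRing R] (M M' d d' N N' : ℕ) :
    X ^ M * (X ^ N - 1) ^ d * (X ^ M' * (X ^ N' - 1) ^ d') ∣
      (X ^ (M + M') * (X ^ (N * N') - 1) ^ (d + d') : R[X]) := by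
  have h : (X ^ N - 1 : R[X]) ∣ X ^ (N * N') - 1 := by
    simpa [pow_mul] using sub_dvd_pow_sub_pow (X ^ N : R[X]) 1 N'
  have h' : (X ^ N' - 1 : R[X]) ∣ X ^ (N * N') - 1 := by
    simpa [pow_mul'] using sub_dvd_pow_sub_pow (X ^ N' : R[X]) 1 N
  rw [mul_mul_mul_comm, pow_add, pow_add]
  exact mul_dvd_mul_left _ (mul_dvd_mul (pow_dvd_pow_of_dvd h d) (pow_dvd_pow_of_dvd h' d'))

theorem aeval_apply_eq_zero_of_dvd {R A : Type*} [CommRing R] [AddCommGroup A] [Module R A]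
    {f : Module.End R A} {p q : R[X]} (hpq : p ∣ q) {x : A} (hx : aeval f p x = 0) :
    aeval f q x = 0 := by
  obtain ⟨r, rfl⟩ := hpq
  rw [mul_comm, map_mul, Module.End.mul_apply, hx, map_zero]

theorem shiftₗ_one_pow_apply {A : Type*} [AddCommGroup A] (k : ℕ) (g : ℕ → A) (m : ℕ) :
    (shiftₗ ℕ A 1 ^ k) g m = g (m + k) := by
  rw [shiftₗ_pow_apply, nsmul_one, Nat.cast_id]

theorem aeval_shiftₗ_X_pow_sub_one {A : Type*} [AddCommGroup A] (N : ℕ) :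
    aeval (shiftₗ ℕ A 1) (X ^ N - 1 : ℤ[X]) = fwdDiffₗ ℕ A N := by
  ext g m
  simp [shiftₗ_one_pow_apply, fwdDiff]

/-- The sequences satisfying a linear recurrence with characteristic polynomial of the form
`X ^ M * (X ^ N - 1) ^ d`, `N > 0`. With values in a field of characteristic zero these are the
sequences that eventually agree with a quasi-polynomial. -/
def quasiPolySeq (A : Type*) [AddCommGroup A] : AddSubgroup (ℕ → A) where
  carrier := {g | ∃ M d N : ℕ, 0 < N ∧ aeval (shiftₗ ℕ A 1) (X ^ M * (X ^ N - 1) ^ d : ℤ[X]) g = 0}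
  zero_mem' := ⟨0, 0, 1, one_pos, map_zero _⟩
  add_mem' := by
    rintro g h ⟨M, d, N, hN, hg⟩ ⟨M', d', N', hN', hh⟩
    have hdvd := X_pow_sub_one_mul_dvd (R := ℤ) M M' d d' N N'
    refine ⟨M + M', d + d', N * N', Nat.mul_pos hN hN', ?_⟩
    rw [map_add, aeval_apply_eq_zero_of_dvd (dvd_of_mul_right_dvd hdvd) hg,
      aeval_apply_eq_zero_of_dvd (dvd_of_mul_left_dvd hdvd) hh, add_zero]
  neg_mem' := by
    rintro g ⟨M, d, N, hN, hg⟩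
    exact ⟨M, d, N, hN, by rw [map_neg, hg, neg_zero]⟩

namespace quasiPolySeq

variable {A : Type*} [AddCommGroup A] {g h : ℕ → A}

theorem aeval_mem (hg : g ∈ quasiPolySeq A) (p : ℤ[X]) :
    aeval (shiftₗ ℕ A 1) p g ∈ quasiPolySeq A := by
  obtain ⟨M, d, N, hN, hg⟩ := hg
  refine ⟨M, d, N, hN, ?_⟩
  rw [← Module.End.mul_apply, ← map_mul]
  exact aeval_apply_eq_zero_of_dvd (dvd_mul_right _ p) hg

theorem mem_of_aeval_mem {M d N : ℕ} (hN : 0 < N)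
    (hg : aeval (shiftₗ ℕ A 1) (X ^ M * (X ^ N - 1) ^ d : ℤ[X]) g ∈ quasiPolySeq A) :
    g ∈ quasiPolySeq A := by
  obtain ⟨M', d', N', hN', hg⟩ := hg
  rw [← Module.End.mul_apply, ← map_mul] at hg
  exact ⟨M' + M, d' + d, N' * N, Nat.mul_pos hN' hN,
    aeval_apply_eq_zero_of_dvd (X_pow_sub_one_mul_dvd M' M d' d N' N) hg⟩

theorem shift_mem_iff (a : ℕ) : (fun m => g (m + a)) ∈ quasiPolySeq A ↔ g ∈ quasiPolySeq A := by
  have hg : aeval (shiftₗ ℕ A 1) (X ^ a * (X ^ 1 - 1) ^ 0 : ℤ[X]) g = fun m => g (m + a) := by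
    funext m
    simp [shiftₗ_one_pow_apply]
  exact ⟨fun h => mem_of_aeval_mem one_pos (hg ▸ h), fun h => hg ▸ aeval_mem h _⟩

theorem mem_of_fwdDiff_mem {a : ℕ} (ha : 0 < a) (hg : Δ_[a] g ∈ quasiPolySeq A) :
    g ∈ quasiPolySeq A := by
  refine mem_of_aeval_mem (M := 0) (d := 1) ha ?_
  rwa [pow_zero, one_mul, pow_one, aeval_shiftₗ_X_pow_sub_one]

theorem mem_congr_of_le {M : ℕ} (hgh : ∀ m, M ≤ m → g m = h m) :
    g ∈ quasiPolySeq A ↔ h ∈ quasiPolySeq A := by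
  rw [← shift_mem_iff M, ← shift_mem_iff (g := h) M]
  simp only [hgh _ (Nat.le_add_left M _)]

theorem exists_fwdDiff_iter_eq_zero (hg : g ∈ quasiPolySeq A) :
    ∃ M d N : ℕ, 0 < N ∧ ∀ m, M ≤ m → ((fwdDiff N)^[d] g) m = 0 := by
  obtain ⟨M, d, N, hN, hg⟩ := hg
  refine ⟨M, d, N, hN, fun m hm => ?_⟩
  obtain ⟨k, rfl⟩ := Nat.exists_eq_add_of_le' hm
  rw [map_mul, map_pow, map_pow, aeval_X, aeval_shiftₗ_X_pow_sub_one, Module.End.mul_apply] at hg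
  rw [← coe_fwdDiffₗ_pow]
  exact (shiftₗ_one_pow_apply M _ k).symm.trans (congrFun hg k)

end quasiPolySeq

section CharZero

variable {K : Type*} [Field K] [CharZero K]

theorem exists_polynomial_eval_natCast_eq_choose (k : ℕ) :
    ∃ P : K[X], ∀ n : ℕ, P.eval (n : K) = n.choose k :=
  ⟨C (k.factorial : K)⁻¹ * descPochhammer K k, fun n => by
    rw [Nat.cast_choose_eq_descPochhammer_div, eval_mul, eval_C, div_eq_inv_mul]⟩

theorem exists_polynomial_eval_of_fwdDiff_iter_eq_zero {g : ℕ → K} {M d N : ℕ}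
    (hg : ∀ m, M ≤ m → ((fwdDiff N)^[d] g) m = 0) :
    ∃ P : K[X], ∀ n : ℕ, g (M + n * N) = P.eval (n : K) := by
  choose B hB using exists_polynomial_eval_natCast_eq_choose (K := K)
  have hzero : ∀ k, d ≤ k → ∀ m, M ≤ m → ((fwdDiff N)^[k] g) m = 0 := by
    intro k hk
    induction k, hk using Nat.le_induction with
    | base => exact hg
    | succ k _ ih =>
      intro m hm
      rw [Function.iterate_succ_apply', fwdDiff, ih _ (hm.trans (Nat.le_add_right m N)), ih m hm,
        sub_zero]
  refine ⟨∑ k ∈ Finset.range d, C (((fwdDiff N)^[k] g) M) * B k, fun n => ?_⟩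
  have hnewton := shift_eq_sum_fwdDiff_iter N g n M
  rw [smul_eq_mul] at hnewton
  rw [hnewton, eval_finsetSum]
  refine Finset.sum_congr_of_eq_on_inter (fun k _ hk => ?_) (fun k _ hk => ?_) fun k _ _ => ?_
  · rw [hzero k (by simpa using hk) M le_rfl, smul_zero]
  · rw [eval_mul, hB, Nat.choose_eq_zero_of_lt (by simpa using hk), Nat.cast_zero, mul_zero]
  · rw [eval_mul, eval_C, hB, nsmul_eq_mul, mul_comm]

end CharZero

theorem isOfQuasiPolynomialType_of_eval_mod {g : ℕ → ℂ} {M N : ℕ} (hN : 0 < N) (Q : ℕ → ℂ[X])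
    (hg : ∀ m, M < m → g m = (Q (m % N)).eval (m : ℂ)) : IsOfQuasiPolynomialType g := by
  refine ⟨M, fun m => (Q (m % N).toNat).eval (m : ℂ),
    ⟨N, hN, fun i => Q i, fun m i hmi => ?_⟩, fun m hm => ?_⟩
  · have hi : m % N = i :=
      Eq.trans hmi (Int.emod_eq_of_lt (by positivity) (by exact_mod_cast i.2))
    simp only [hi, Int.toNat_natCast]
  · simp only [hg m hm, ← Int.natCast_mod, Int.toNat_natCast, Int.cast_natCast]

theorem isOfQuasiPolynomialType_of_mem_quasiPolySeq {g : ℕ → ℂ} (hg : g ∈ quasiPolySeq ℂ) :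
    IsOfQuasiPolynomialType g := by
  obtain ⟨M, d, N, hN, hg⟩ := quasiPolySeq.exists_fwdDiff_iter_eq_zero hg
  have hMN (i : ℕ) : M ≤ i + M * N := (Nat.le_mul_of_pos_right M hN).trans (Nat.le_add_left _ i)
  choose P hP using fun i : ℕ =>
    exists_polynomial_eval_of_fwdDiff_iter_eq_zero fun m hm => hg m ((hMN i).trans hm)
  refine isOfQuasiPolynomialType_of_eval_mod (M := M * N) hN
    (fun i => (P i).comp (C (N : ℂ)⁻¹ * (X - C ((i + M * N : ℕ) : ℂ)))) fun m hm => ?_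
  obtain ⟨n, hn⟩ : ∃ n, m = m % N + M * N + n * N := by
    obtain ⟨n, hn⟩ := Nat.exists_eq_add_of_le ((Nat.le_div_iff_mul_le hN).2 hm.le)
    exact ⟨n, by rw [add_assoc, ← add_mul, ← hn, mul_comm, Nat.mod_add_div]⟩
  have heval : (N : ℂ)⁻¹ * (m - (m % N + M * N : ℕ)) = n := by
    rw [inv_mul_eq_iff_eq_mul₀ (Nat.cast_ne_zero.2 hN.ne'), sub_eq_iff_eq_add']
    exact_mod_cast hn.trans (by rw [mul_comm n])
  conv_lhs => rw [hn]
  rw [hP, eval_comp, eval_mul, eval_sub, eval_C, eval_C, eval_X, heval]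

end Sequences

/-- The set `s`, graded by `w`, has finite fibres, and the cardinalities of the fibres form an
eventually quasi-polynomial sequence. -/
structure HasQuasiPolyCount {X : Type*} (w : X → ℕ) (s : Set X) : Prop where
  finite_fiber : ∀ i, (s ∩ w ⁻¹' {i}).Finite
  ncard_mem : (fun i => ((s ∩ w ⁻¹' {i}).ncard : ℂ)) ∈ quasiPolySeq ℂ

namespace HasQuasiPolyCount

variable {X Y ι : Type*} {w : X → ℕ} {v : Y → ℕ} {s t : Set X} {f : X → Y} {a : ℕ}

protected theorem empty : HasQuasiPolyCount w ∅ :=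
  ⟨by simp, by simp only [empty_inter, ncard_empty, Nat.cast_zero]; exact zero_mem _⟩

protected theorem singleton (x : X) : HasQuasiPolyCount w {x} := by
  refine ⟨fun i => (finite_singleton x).inter_of_left _, ?_⟩
  refine (quasiPolySeq.mem_congr_of_le (M := w x + 1) fun i hi => ?_).2 (zero_mem _)
  have hfiber : {x} ∩ w ⁻¹' {i} = ∅ :=
    singleton_inter_eq_empty.2 (Nat.lt_of_succ_le hi).ne
  simp [hfiber]

theorem union (hs : HasQuasiPolyCount w s) (ht : HasQuasiPolyCount w t)
    (hst : HasQuasiPolyCount w (s ∩ t)) : HasQuasiPolyCount w (s ∪ t) := by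
  refine ⟨fun i => ?_, ?_⟩
  · rw [union_inter_distrib_right]
    exact (hs.finite_fiber i).union (ht.finite_fiber i)
  · convert sub_mem (add_mem hs.ncard_mem ht.ncard_mem) hst.ncard_mem using 1
    funext i
    have hcard := ncard_union_add_ncard_inter _ _ (hs.finite_fiber i) (ht.finite_fiber i)
    rw [← union_inter_distrib_right, ← inter_inter_distrib_right] at hcard
    simp only [Pi.add_apply, Pi.sub_apply]
    exact eq_sub_of_add_eq (by exact_mod_cast hcard)

theorem union_of_disjoint (hs : HasQuasiPolyCount w s) (ht : HasQuasiPolyCount w t)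
    (hst : Disjoint s t) : HasQuasiPolyCount w (s ∪ t) :=
  hs.union ht (hst.inter_eq ▸ .empty)

theorem sdiff (hs : HasQuasiPolyCount w s) (ht : HasQuasiPolyCount w t) (hts : t ⊆ s) :
    HasQuasiPolyCount w (s \ t) := by
  refine ⟨fun i => (hs.finite_fiber i).subset (inter_subset_inter_left _ sdiff_subset), ?_⟩
  convert sub_mem hs.ncard_mem ht.ncard_mem using 1
  funext i
  have hcard := ncard_sdiff_add_ncard_of_subset (inter_subset_inter_left (w ⁻¹' {i}) hts)
    (hs.finite_fiber i)
  rw [← inter_sdiff_distrib_right] at hcard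
  simp only [Pi.sub_apply]
  exact eq_sub_of_add_eq (by exact_mod_cast hcard)

theorem biUnion_of_inter {p : Set X → Prop} (hp : ∀ s, p s → HasQuasiPolyCount w s)
    (hinter : ∀ s t, p s → p t → p (s ∩ t)) {I : Set ι} (hI : I.Finite) {S : ι → Set X}
    (hS : ∀ i ∈ I, p (S i)) : HasQuasiPolyCount w (⋃ i ∈ I, S i) := by
  induction I, hI using Set.Finite.induction_on generalizing S with
  | empty => simpa using HasQuasiPolyCount.empty
  | @insert j I _ _ ih =>
    rw [forall_mem_insert] at hS
    rw [biUnion_insert]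
    refine (hp _ hS.1).union (ih hS.2) ?_
    rw [inter_iUnion₂]
    exact ih fun i hi => hinter _ _ hS.1 (hS.2 i hi)

theorem biUnion_of_pairwiseDisjoint {I : Set ι} (hI : I.Finite) {S : ι → Set X}
    (hS : ∀ i ∈ I, HasQuasiPolyCount w (S i)) (hdisj : I.PairwiseDisjoint S) :
    HasQuasiPolyCount w (⋃ i ∈ I, S i) := by
  induction I, hI using Set.Finite.induction_on with
  | empty => simpa using HasQuasiPolyCount.empty
  | @insert j I hj _ ih =>
    rw [forall_mem_insert] at hS
    rw [pairwiseDisjoint_insert_of_notMem hj] at hdisj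
    rw [biUnion_insert]
    exact hS.1.union_of_disjoint (ih hS.2 hdisj.1) (disjoint_iUnion₂_right.2 hdisj.2)

theorem fiber_image_add (hvw : ∀ x ∈ s, v (f x) = w x + a) (i : ℕ) :
    f '' s ∩ v ⁻¹' {i + a} = f '' (s ∩ w ⁻¹' {i}) := by
  rw [← image_inter_preimage]
  congr 1
  ext x
  simp only [mem_inter_iff, mem_preimage, mem_singleton_iff]
  exact and_congr_right fun hx => by rw [hvw x hx, Nat.add_right_cancel_iff]

theorem fiber_image_of_lt (hvw : ∀ x ∈ s, v (f x) = w x + a) {i : ℕ} (hi : i < a) :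
    f '' s ∩ v ⁻¹' {i} = ∅ := by
  rw [← image_inter_preimage, image_eq_empty]
  refine eq_empty_of_forall_notMem fun x hx => ?_
  have hxi : v (f x) = i := hx.2
  rw [hvw x hx.1] at hxi
  omega

theorem finite_fiber_image (hvw : ∀ x ∈ s, v (f x) = w x + a) {i : ℕ}
    (hs : ∀ k, i = k + a → (s ∩ w ⁻¹' {k}).Finite) : (f '' s ∩ v ⁻¹' {i}).Finite := by
  rcases lt_or_ge i a with hi | hi
  · simp [fiber_image_of_lt hvw hi]
  · obtain ⟨k, rfl⟩ := Nat.exists_eq_add_of_le' hi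
    rw [fiber_image_add hvw]
    exact (hs k rfl).image f

theorem ncard_fiber_image_add (hf : InjOn f s) (hvw : ∀ x ∈ s, v (f x) = w x + a) (i : ℕ) :
    (f '' s ∩ v ⁻¹' {i + a}).ncard = (s ∩ w ⁻¹' {i}).ncard := by
  rw [fiber_image_add hvw, (hf.mono inter_subset_left).ncard_image]

theorem image (hs : HasQuasiPolyCount w s) (hf : InjOn f s)
    (hvw : ∀ x ∈ s, v (f x) = w x + a) : HasQuasiPolyCount v (f '' s) := by
  refine ⟨fun i => finite_fiber_image hvw fun k _ => hs.finite_fiber k,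
    (quasiPolySeq.shift_mem_iff a).1 ?_⟩
  simp only [ncard_fiber_image_add hf hvw]
  exact hs.ncard_mem

theorem of_sdiff_image {f : X → X} (hs : HasQuasiPolyCount w (s \ f '' s)) (hmaps : MapsTo f s s)
    (hf : InjOn f s) (ha : 0 < a) (hw : ∀ x ∈ s, w (f x) = w x + a) :
    HasQuasiPolyCount w s := by
  have hunion (i : ℕ) : s ∩ w ⁻¹' {i} = (s \ f '' s) ∩ w ⁻¹' {i} ∪ f '' s ∩ w ⁻¹' {i} := by
    rw [← union_inter_distrib_right, sdiff_union_of_subset hmaps.image_subset]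
  have hfin (i : ℕ) : (s ∩ w ⁻¹' {i}).Finite := by
    induction i using Nat.strong_induction_on with
    | _ i ih =>
      rw [hunion]
      exact (hs.finite_fiber i).union (finite_fiber_image hw fun k hk => ih k (by omega))
  refine ⟨hfin, quasiPolySeq.mem_of_fwdDiff_mem ha ?_⟩
  convert (quasiPolySeq.shift_mem_iff a).2 hs.ncard_mem using 1
  funext i
  have hdisj : Disjoint ((s \ f '' s) ∩ w ⁻¹' {i + a}) (f '' s ∩ w ⁻¹' {i + a}) :=
    disjoint_sdiff_left.mono inter_subset_left inter_subset_left
  rw [fwdDiff, sub_eq_iff_eq_add, hunion (i + a), ncard_union_eq hdisj (hs.finite_fiber _)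
    (finite_fiber_image hw fun k _ => hfin k), ncard_fiber_image_add hf hw, Nat.cast_add]

end HasQuasiPolyCount

section Orthant

variable {ι : Type*} [Finite ι]

theorem hasQuasiPolyCount_univ (w : (ι → ℕ) →+ ℕ) (hw : ∀ c, w c = 0 → c = 0) :
    HasQuasiPolyCount w univ := by
  classical
  suffices h : ∀ T : Set ι, HasQuasiPolyCount w {c | ∀ i ∉ T, c i = 0} by simpa using h univ
  intro T
  induction T, T.toFinite using Set.Finite.induction_on with
  | empty =>
    convert HasQuasiPolyCount.singleton (0 : ι → ℕ)
    ext c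
    simp [funext_iff]
  | @insert j T hj _ ih =>
    set s : Set (ι → ℕ) := {c | ∀ i ∉ insert j T, c i = 0}
    have hmaps : MapsTo (· + Pi.single j 1) s s := fun c hc i hi => by
      simp [hc i hi, ne_of_mem_of_not_mem (mem_insert j T) hi |>.symm]
    have hsdiff : s \ (· + Pi.single j 1) '' s = {c | ∀ i ∉ T, c i = 0} := by
      ext c
      constructor
      · rintro ⟨hc, hc'⟩ i hi
        rcases eq_or_ne i j with rfl | hij
        · by_contra hci
          refine hc' ⟨c - Pi.single i 1, fun k hk => by simp [hc k hk], tsub_add_cancel_of_le ?_⟩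
          exact update_le_iff.2 ⟨Nat.one_le_iff_ne_zero.2 hci, fun _ _ => Nat.zero_le _⟩
        · exact hc i (by simp [hij, hi])
      · refine fun hc => ⟨fun i hi => hc i fun h => hi (mem_insert_of_mem _ h), ?_⟩
        rintro ⟨d, -, rfl⟩
        simpa using hc j hj
    have hpos : 0 < w (Pi.single j 1) := Nat.pos_of_ne_zero fun h => by
      simpa using congrFun (hw _ h) j
    exact .of_sdiff_image (hsdiff ▸ ih) hmaps (add_left_injective _).injOn hpos
      fun c _ => map_add w c _

theorem hasQuasiPolyCount_Ici (w : (ι → ℕ) →+ ℕ) (hw : ∀ c, w c = 0 → c = 0) (a : ι → ℕ) :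
    HasQuasiPolyCount w (Ici a) := by
  have himage : (· + a) '' univ = Ici a := by
    ext c
    simp [le_iff_exists_add', eq_comm]
  exact himage ▸ (hasQuasiPolyCount_univ w hw).image (add_left_injective a).injOn
    fun c _ => map_add w c a

theorem hasQuasiPolyCount_of_isUpperSet (w : (ι → ℕ) →+ ℕ) (hw : ∀ c, w c = 0 → c = 0)
    {U : Set (ι → ℕ)} (hU : IsUpperSet U) : HasQuasiPolyCount w U := by
  have hfin : {c | Minimal (· ∈ U) c}.Finite :=
    WellQuasiOrderedLE.finite_of_isAntichain (setOfPred_minimal_antichain _)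
  have hunion : ⋃ c ∈ {c | Minimal (· ∈ U) c}, Ici c = U := by
    refine (iUnion₂_subset fun c hc d hd => hU hd hc.1).antisymm fun c hc => ?_
    obtain ⟨m, hmc, hm⟩ := exists_minimal_le_of_wellFoundedLT (· ∈ U) c hc
    exact mem_biUnion hm hmc
  rw [← hunion]
  refine .biUnion_of_inter (p := (· ∈ range Ici)) ?_ ?_ hfin fun c _ => mem_range_self c
  · rintro _ ⟨a, rfl⟩
    exact hasQuasiPolyCount_Ici w hw a
  · rintro _ _ ⟨a, rfl⟩ ⟨b, rfl⟩
    exact ⟨a ⊔ b, Ici_inter_Ici.symm⟩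

end Orthant

section Representatives

theorem exists_isUpperSet_injOn_compl_image_compl_eq {ι X : Type*} [LinearOrder ι] [Finite ι]
    (f : (ι → ℕ) → X) (hf : ∀ c d e, f c = f d → f (c + e) = f (d + e)) {A : Set X}
    (hA : ∀ c e, f c ∈ A → f (c + e) ∈ A) :
    ∃ U, IsUpperSet U ∧ InjOn f Uᶜ ∧ f '' Uᶜ = range f \ A := by
  -- Outside `U`, the vectors `c` are the lexicographically least ones with the same `f c`.
  refine ⟨{c | f c ∈ A ∨ ∃ d, toLex d < toLex c ∧ f d = f c}, ?_, ?_, Subset.antisymm ?_ ?_⟩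
  · intro c c' hcc' hc
    obtain ⟨e, rfl⟩ := exists_add_of_le hcc'
    rcases hc with hc | ⟨d, hdc, hd⟩
    · exact Or.inl (hA c e hc)
    · exact Or.inr ⟨d + e, add_lt_add_left hdc (toLex e), hf d c e hd⟩
  · intro c hc d hd hcd
    rcases lt_trichotomy (toLex c) (toLex d) with hlt | heq | hlt
    · exact absurd (Or.inr ⟨c, hlt, hcd⟩) hd
    · exact toLex.injective heq
    · exact absurd (Or.inr ⟨d, hlt, hcd.symm⟩) hc
  · rintro _ ⟨c, hc, rfl⟩
    exact ⟨mem_range_self c, fun h => hc (Or.inl h)⟩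
  · rintro _ ⟨⟨c, rfl⟩, hcA⟩
    obtain ⟨d, hd : f (ofLex d) = f c, hmin⟩ := WellFounded.has_min
      (wellFounded_lt (α := Lex (ι → ℕ))) {d | f (ofLex d) = f c} ⟨toLex c, rfl⟩
    refine ⟨ofLex d, ?_, hd⟩
    rintro (h | ⟨e, hed, he⟩)
    · exact hcA (hd.subst (motive := (· ∈ A)) h)
    · exact hmin (toLex e) (he.trans hd) hed

end Representatives

section GradedModules

variable {M : Type*} [AddCommMonoid M] [AddMonoid.FG M] {w : M →+ ℕ}

theorem exists_surjective_addMonoidHom_of_weight_pos (hw : ∀ m, w m = 0 → m = 0) :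
    ∃ (k : ℕ) (φ : (Fin k → ℕ) →+ M), Function.Surjective φ ∧ ∀ c, w (φ c) = 0 → c = 0 := by
  classical
  obtain ⟨t, ht⟩ := AddMonoid.FG.fg_top (M := M)
  let g : Fin (t.erase 0).card → M := Subtype.val ∘ (t.erase 0).equivFin.symm
  have hrange : range g = (t : Set M) \ {0} := by
    rw [EquivLike.range_comp, Subtype.range_coe, Finset.coe_erase]
  refine ⟨_, (Fintype.linearCombination ℕ g).toAddMonoidHom, ?_, fun c hc => ?_⟩
  · have htop : Submodule.span ℕ (range g) = ⊤ := by
      apply Submodule.toAddSubmonoid_injective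
      rw [hrange, Submodule.span_sdiff_singleton_zero,
        Submodule.span_nat_eq_addSubmonoidClosure, ht, Submodule.top_toAddSubmonoid]
    exact LinearMap.range_eq_top.1 ((Fintype.range_linearCombination ℕ g).trans htop)
  · have hsum : ∑ i, c i * w (g i) = 0 := by
      simpa [Fintype.linearCombination_apply] using hc
    funext i
    have hgi : g i ≠ 0 := fun h => (hrange.subset (mem_range_self i)).2 h
    simpa [(hw (g i)).mt hgi] using Finset.sum_eq_zero_iff.1 hsum i (Finset.mem_univ i)

variable {X : Type*} [AddAction M X] {v : X → ℕ}

theorem hasQuasiPolyCount_orbit_sdiff (hw : ∀ m, w m = 0 → m = 0)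
    (hv : ∀ m x, v (m +ᵥ x) = w m + v x) {A : Set X} (hA : ∀ m : M, ∀ x ∈ A, m +ᵥ x ∈ A) (x : X) :
    HasQuasiPolyCount v (AddAction.orbit M x \ A) := by
  obtain ⟨k, φ, hφ, hwφ⟩ := exists_surjective_addMonoidHom_of_weight_pos hw
  let f : (Fin k → ℕ) → X := fun c => φ c +ᵥ x
  have hf (c e) : f (c + e) = φ e +ᵥ f c := by
    simp only [f, map_add, add_comm (φ c), add_vadd]
  have hrange : range f = AddAction.orbit M x := hφ.range_comp (· +ᵥ x)
  obtain ⟨U, hU, hinj, himage⟩ := exists_isUpperSet_injOn_compl_image_compl_eq f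
    (fun c d e hcd => by rw [hf, hf, hcd]) (fun c e hc => hf c e ▸ hA _ _ hc)
  rw [← hrange, ← himage, compl_eq_univ_sdiff]
  refine ((hasQuasiPolyCount_univ (w.comp φ) hwφ).sdiff
    (hasQuasiPolyCount_of_isUpperSet _ hwφ hU) (subset_univ U)).image (a := v x) ?_
      fun c _ => hv _ _
  rwa [← compl_eq_univ_sdiff]

theorem hasQuasiPolyCount_biUnion_orbit (hw : ∀ m, w m = 0 → m = 0)
    (hv : ∀ m x, v (m +ᵥ x) = w m + v x) {F : Set X} (hF : F.Finite) :
    HasQuasiPolyCount v (⋃ x ∈ F, AddAction.orbit M x) := by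
  induction F, hF using Set.Finite.induction_on with
  | empty => simpa using HasQuasiPolyCount.empty
  | @insert x F _ _ ih =>
    have hA (m : M) (y : X) (hy : y ∈ ⋃ x ∈ F, AddAction.orbit M x) :
        m +ᵥ y ∈ ⋃ x ∈ F, AddAction.orbit M x := by
      obtain ⟨z, hz, hy⟩ := mem_iUnion₂.1 hy
      exact mem_iUnion₂.2 ⟨z, hz, AddAction.mem_orbit_of_mem_orbit m hy⟩
    rw [biUnion_insert, ← sdiff_union_self]
    exact (hasQuasiPolyCount_orbit_sdiff hw hv hA x).union_of_disjoint ih disjoint_sdiff_left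

end GradedModules

section PositiveModules

theorem exists_finite_setOf_add_eq_add_eq {A G : Type*} [AddCommMonoid A] [PartialOrder A]
    [WellQuasiOrderedLE A] [CanonicallyOrderedAdd A] [AddMonoid G] [IsLeftCancelAdd G]
    (φ ψ : A →+ G) (f f' : G) :
    ∃ D : Set A, D.Finite ∧ {c | f + φ c = f' + ψ c} = D + (φ.eqLocusM ψ : Set A) := by
  refine ⟨{c | Minimal (fun c => f + φ c = f' + ψ c) c},
    WellQuasiOrderedLE.finite_of_isAntichain (setOfPred_minimal_antichain _),
    Subset.antisymm (fun c hc => ?_) ?_⟩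
  · obtain ⟨m, hmc, hm⟩ := exists_minimal_le_of_wellFoundedLT (fun c => f + φ c = f' + ψ c) c hc
    obtain ⟨e, rfl⟩ := exists_add_of_le hmc
    refine add_mem_add hm (add_left_cancel (a := f + φ m) ?_)
    have hc' : f + φ (m + e) = f' + ψ (m + e) := hc
    rwa [map_add, map_add, ← add_assoc, ← add_assoc, ← hm.prop] at hc'
  · rintro _ ⟨m, hm, e, he, rfl⟩
    have hm' : f + φ m = f' + ψ m := hm.1
    have he' : φ e = ψ e := he
    simp only [mem_ofPred_eq, map_add, ← add_assoc, he', hm']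

variable {G : Type*} [AddCommMonoid G]

/-- `s` is a finitely generated module over a finitely generated submonoid of `G` all of whose
nonzero elements have positive weight. -/
def IsPositiveFGModule (w : G →+ ℕ) (s : Set G) : Prop :=
  ∃ (F : Set G) (M : AddSubmonoid G), F.Finite ∧ M.FG ∧ (∀ m ∈ M, w m = 0 → m = 0) ∧
    s = F + (M : Set G)

theorem IsPositiveFGModule.hasQuasiPolyCount {w : G →+ ℕ} {s : Set G}
    (hs : IsPositiveFGModule w s) : HasQuasiPolyCount w s := by
  obtain ⟨F, M, hF, hM, hw, rfl⟩ := hs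
  have hM' : AddMonoid.FG M := (AddMonoid.fg_iff_addSubmonoid_fg M).2 hM
  have horbit : F + (M : Set G) = ⋃ f ∈ F, AddAction.orbit M f := by
    ext x
    simp [mem_add, AddAction.mem_orbit_iff, AddSubmonoid.vadd_def, add_comm]
  rw [horbit]
  exact hasQuasiPolyCount_biUnion_orbit (w := w.comp M.subtype)
    (fun m hm => Subtype.ext (hw m m.2 hm)) (fun m x => map_add w (m : G) x) hF

variable [IsCancelAdd G] {w : G →+ ℕ}

theorem IsPositiveFGModule.inter {s t : Set G} (hs : IsPositiveFGModule w s)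
    (ht : IsPositiveFGModule w t) : IsPositiveFGModule w (s ∩ t) := by
  obtain ⟨F, M, hF, hM, hw, rfl⟩ := hs
  obtain ⟨F', M', hF', hM', -, rfl⟩ := ht
  obtain ⟨k, φ, rfl⟩ := AddSubmonoid.fg_iff_exists_fin_addMonoidHom.1 hM
  obtain ⟨l, ψ, rfl⟩ := AddSubmonoid.fg_iff_exists_fin_addMonoidHom.1 hM'
  let φ' : (Fin k → ℕ) × (Fin l → ℕ) →+ G := φ.comp (AddMonoidHom.fst _ _)
  let ψ' : (Fin k → ℕ) × (Fin l → ℕ) →+ G := ψ.comp (AddMonoidHom.snd _ _)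
  choose D hDfin hD using exists_finite_setOf_add_eq_add_eq φ' ψ'
  refine ⟨⋃ f ∈ F, ⋃ f' ∈ F', (f + φ' ·) '' D f f', (φ'.eqLocusM ψ').map φ',
    hF.biUnion fun f _ => hF'.biUnion fun f' _ => (hDfin f f').image _,
    (AddSubmonoid.fg_eqLocusM φ' ψ').map φ', ?_, Subset.antisymm ?_ ?_⟩
  · rintro _ ⟨c, -, rfl⟩
    exact hw _ ⟨c.1, rfl⟩
  · rintro _ ⟨⟨f, hf, _, ⟨c, rfl⟩, rfl⟩, ⟨f', hf', _, ⟨c', rfl⟩, hcc'⟩⟩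
    obtain ⟨d, hd, e, he, hde⟩ := (hD f f').subset (show (c, c') ∈ _ from hcc'.symm)
    refine ⟨f + φ' d, mem_biUnion hf (mem_biUnion hf' ⟨d, hd, rfl⟩), φ' e, ⟨e, he, rfl⟩, ?_⟩
    calc f + φ' d + φ' e = f + φ' (d + e) := by rw [map_add, add_assoc]
      _ = f + φ c := by rw [show d + e = (c, c') from hde]; rfl
  · rintro _ ⟨y, hy, _, ⟨e, he, rfl⟩, rfl⟩
    obtain ⟨f, hf, hy⟩ := mem_iUnion₂.1 hy
    obtain ⟨f', hf', d, hd, rfl⟩ := mem_iUnion₂.1 hy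
    have hde : f + φ' (d + e) = f' + ψ' (d + e) := (hD f f').superset (add_mem_add hd he)
    have hassoc : f + φ' d + φ' e = f + φ' (d + e) := by rw [map_add, add_assoc]
    exact ⟨⟨f, hf, φ' (d + e), ⟨(d + e).1, rfl⟩, hassoc.symm⟩,
      ⟨f', hf', ψ' (d + e), ⟨(d + e).2, rfl⟩, (hassoc.trans hde).symm⟩⟩

end PositiveModules

section Semilinear

variable {G : Type*} [AddCancelCommMonoid G] [IsAddTorsionFree G] {w : G →+ ℕ}

theorem isPositiveFGModule_of_isLinearSet {s : Set G} (hs : IsLinearSet s)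
    (hfin : ∀ i, (s ∩ w ⁻¹' {i}).Finite) : IsPositiveFGModule w s := by
  obtain ⟨a, M, hM, rfl⟩ := isLinearSet_iff_exists_fg_eq_vadd.1 hs
  refine ⟨{a}, M, finite_singleton a, hM, fun m hm hwm => ?_, by
    simp [singleton_add, ← image_vadd]⟩
  by_contra hm0
  have hinj : Function.Injective fun n : ℕ => a + n • m :=
    (add_right_injective a).comp
      (injective_nsmul_iff_not_isOfFinAddOrder.2 (not_isOfFinAddOrder_of_isAddTorsionFree hm0))
  refine infinite_range_of_injective hinj ((hfin (w a)).subset ?_)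
  rintro _ ⟨n, rfl⟩
  exact ⟨vadd_mem_vadd_set (nsmul_mem hm n), by simp [hwm]⟩

theorem hasQuasiPolyCount_of_isSemilinearSet {s : Set G}
    (hs : IsSemilinearSet s) (hfin : ∀ i, (s ∩ w ⁻¹' {i}).Finite) : HasQuasiPolyCount w s := by
  obtain ⟨S, hS, hlin, rfl⟩ := hs
  rw [sUnion_eq_biUnion]
  refine .biUnion_of_inter (p := IsPositiveFGModule w) (fun _ h => h.hasQuasiPolyCount)
    (fun _ _ => .inter) hS fun t ht => ?_
  exact isPositiveFGModule_of_isLinearSet (hlin t ht) fun i =>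
    (hfin i).subset (inter_subset_inter_left _ (subset_sUnion_of_mem ht))

end Semilinear

section LabelPaths

/-- `LabelPath T S a b g`: there is a nonempty path from `a` to `b`, with all intermediate vertices
in `S`, whose labels, taken from the sets `T`, add up to `g`. -/
inductive LabelPath {V G : Type*} [AddMonoid G] (T : V → V → Set G) (S : Set V) :
    V → V → G → Prop
  | single {a b : V} {g : G} : g ∈ T a b → LabelPath T S a b g
  | cons {a c b : V} {g h : G} : g ∈ T a c → c ∈ S → LabelPath T S c b h → LabelPath T S a b (g + h)

namespace LabelPath

section AddMonoid

variable {V G : Type*} [AddMonoid G] {T : V → V → Set G} {S S' : Set V} {a b c : V} {g h : G}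

theorem mono (hS : S ⊆ S') (p : LabelPath T S a b g) : LabelPath T S' a b g := by
  induction p with
  | single h => exact .single h
  | cons h hc _ ih => exact .cons h (hS hc) ih

theorem trans (hc : c ∈ S) (p : LabelPath T S a c g) (q : LabelPath T S c b h) :
    LabelPath T S a b (g + h) := by
  induction p with
  | single h => exact .cons h hc q
  | cons h hd _ ih =>
    rw [add_assoc]
    exact .cons h hd (ih hc q)

theorem add_mem_closure (hc : c ∈ S) (p : LabelPath T S a c g)
    (hh : h ∈ AddSubmonoid.closure {h | LabelPath T S c c h}) : LabelPath T S a c (g + h) := by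
  induction hh using AddSubmonoid.closure_induction generalizing g with
  | mem h hh => exact p.trans hc hh
  | zero => rwa [add_zero]
  | add x y _ _ hx hy =>
    rw [← add_assoc]
    exact hy (hx p)

theorem setOf_empty : {g | LabelPath T ∅ a b g} = T a b := by
  ext g
  refine ⟨?_, .single⟩
  rintro (hg | ⟨-, hc, -⟩)
  · exact hg
  · exact hc.elim

theorem setOf_insert (k : V) : {g | LabelPath T (insert k S) a b g} =
    {g | LabelPath T S a b g} ∪ ({g | LabelPath T S a k g} +
      (AddSubmonoid.closure {g | LabelPath T S k k g} : Set G) + {g | LabelPath T S k b g}) := by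
  refine Subset.antisymm (fun g p => ?_) (union_subset (fun g p => p.mono (subset_insert k S)) ?_)
  · induction p with
    | single hg => exact Or.inl (.single hg)
    | @cons a c b g h hg hc _ ih =>
      rcases hc with rfl | hc
      · rcases ih with ih | ⟨_, ⟨g₁, p₁, g₂, hg₂, rfl⟩, g₃, p₃, rfl⟩
        · exact Or.inr ⟨g, ⟨g, .single hg, 0, zero_mem _, add_zero g⟩, h, ih, rfl⟩
        · exact Or.inr ⟨g + (g₁ + g₂), ⟨g, .single hg, g₁ + g₂,
            add_mem (AddSubmonoid.subset_closure p₁) hg₂, rfl⟩, g₃, p₃, add_assoc _ _ _⟩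
      · rcases ih with ih | ⟨_, ⟨g₁, p₁, g₂, hg₂, rfl⟩, g₃, p₃, rfl⟩
        · exact Or.inl (.cons hg hc ih)
        · exact Or.inr ⟨g + g₁ + g₂, ⟨g + g₁, .cons hg hc p₁, g₂, hg₂, rfl⟩, g₃, p₃, by
            simp only [add_assoc]⟩
  · rintro _ ⟨_, ⟨g₁, p₁, g₂, hg₂, rfl⟩, g₃, p₃, rfl⟩
    have hsub : S ⊆ insert k S := subset_insert k S
    have hg₂' : g₂ ∈ AddSubmonoid.closure {g | LabelPath T (insert k S) k k g} :=
      AddSubmonoid.closure_mono (fun _ p => p.mono hsub) hg₂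
    exact ((p₁.mono hsub).add_mem_closure (mem_insert k S) hg₂').trans (mem_insert k S)
      (p₃.mono hsub)

end AddMonoid

-- Kleene's algorithm: the intermediate vertices are admitted one at a time.
theorem isSemilinearSet {V G : Type*} [AddCommMonoid G] {T : V → V → Set G} {S : Set V}
    (hS : S.Finite) (hT : ∀ a b, IsSemilinearSet (T a b)) (a b : V) :
    IsSemilinearSet {g | LabelPath T S a b g} := by
  induction S, hS using Set.Finite.induction_on generalizing a b with
  | empty =>
    rw [setOf_empty]
    exact hT a b
  | @insert k S _ _ ih =>
    rw [setOf_insert]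
    exact (ih a b).union (((ih a k).add (ih k k).closure).add (ih k b))

end LabelPath

end LabelPaths

theorem mem_subAddAction_closure_iff {L V : Type*} [AddMonoid L] [AddAction L V]
    {F : Set V} {y : V} : y ∈ SubAddAction.closure L F ↔ ∃ x ∈ F, y ∈ AddAction.orbit L x := by
  constructor
  · intro h
    let P : SubAddAction L V :=
      { carrier := {y | ∃ x ∈ F, y ∈ AddAction.orbit L x}
        vadd_mem' := fun u _ ⟨x, hx, hy⟩ => ⟨x, hx, AddAction.mem_orbit_of_mem_orbit u hy⟩ }
    exact SubAddAction.mem_closure.1 h P fun x hx => ⟨x, hx, AddAction.mem_orbit_self x⟩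
  · rintro ⟨x, hx, u, rfl⟩
    exact SubAddAction.vadd_mem _ u (SubAddAction.mem_closure_of_mem hx)

namespace WeightedDigraph

section Distance

variable {V E : Type*} (Γ : WeightedDigraph V E)

theorem dist_le_iff {x y : V} {i : ℕ} :
    Γ.dist x y ≤ i ↔ ∃ p, Γ.IsWalk x p y ∧ Γ.walkWeight p ≤ i := by
  constructor
  · intro h
    have hlt : Γ.dist x y < (i : ℕ∞) + 1 :=
      lt_of_le_of_lt h (by exact_mod_cast Nat.lt_succ_self i)
    simp only [dist, iInf_lt_iff] at hlt
    obtain ⟨p, hp, hw⟩ := hlt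
    exact ⟨p, hp, Nat.lt_succ_iff.1 (by exact_mod_cast hw)⟩
  · rintro ⟨p, hp, h⟩
    exact (iInf₂_le p hp).trans (by exact_mod_cast h)

theorem walkWeight_cons (e : E) (p : List E) :
    Γ.walkWeight (e :: p) = Γ.weight e + Γ.walkWeight p := by
  simp [walkWeight]

theorem finite_setOf_dist_le (hΓ : ∀ x, {e | Γ.src e = x}.Finite) (x : V) (i : ℕ) :
    {y | Γ.dist x y ≤ i}.Finite := by
  simp only [dist_le_iff]
  induction i using Nat.strong_induction_on generalizing x with
  | _ i ih =>
    have hfin : (⋃ e ∈ {e | Γ.src e = x ∧ Γ.weight e ≤ i},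
        {y | ∃ p, Γ.IsWalk (Γ.tgt e) p y ∧ Γ.walkWeight p ≤ i - Γ.weight e}).Finite :=
      ((hΓ x).subset fun e he => he.1).biUnion fun e he =>
        ih _ (Nat.sub_lt_self (Γ.weight_pos e) he.2) _
    refine ((finite_singleton x).union hfin).subset ?_
    rintro y ⟨_ | ⟨e, p⟩, hp, hi⟩
    · exact Or.inl hp.symm
    · rw [walkWeight_cons] at hi
      exact Or.inr (mem_biUnion ⟨hp.1, le_of_add_le_left hi⟩ ⟨p, hp.2, Nat.le_sub_of_add_le' hi⟩)

end Distance

/-- The pairs (weight, translation) of the edges from `a` to the orbit of `b`. They label a finite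
quotient graph whose label paths, lifted by translation, are the walks of a periodic graph. -/
def edgeLabels {V E : Type*} (Γ : WeightedDigraph V E) (L : Type*) [VAdd L V] (a b : V) :
    Set (ℕ × L) :=
  {g | ∃ e, Γ.src e = a ∧ Γ.tgt e = g.2 +ᵥ b ∧ Γ.weight e = g.1}

namespace IsPeriodic

variable {V E L : Type*} [AddCommGroup L] [AddAction L V] [AddAction L E]
  {Γ : WeightedDigraph V E} {n : ℕ}

theorem isAddTorsionFree (hΓ : Γ.IsPeriodic L n) : IsAddTorsionFree L := by
  obtain ⟨e⟩ := hΓ.lattice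
  exact e.injective.isAddTorsionFree e.toAddMonoidHom

theorem fg_addSubgroup (hΓ : Γ.IsPeriodic L n) (L' : AddSubgroup L) : L'.FG := by
  obtain ⟨e⟩ := hΓ.lattice
  have : IsNoetherian ℤ L := isNoetherian_of_linearEquiv e.toIntLinearEquiv.symm
  have h := IsNoetherian.noetherian (AddSubgroup.toIntSubmodule L')
  rwa [Submodule.fg_iff_addSubgroup_fg] at h

theorem vadd_left_injective (hΓ : Γ.IsPeriodic L n) (x : V) :
    Function.Injective (· +ᵥ x : L → V) := by
  intro u v (huv : u +ᵥ x = v +ᵥ x)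
  refine (neg_add_eq_zero.1 (hΓ.free_vertices (-v + u) x ?_)).symm
  rw [add_vadd, huv, neg_vadd_vadd]

theorem finite_setOf_src_eq (hΓ : Γ.IsPeriodic L n) (x : V) : {e | Γ.src e = x}.Finite := by
  have := hΓ.finite_edges
  refine Set.Finite.of_injOn (f := Quotient.mk (AddAction.orbitRel L E)) (t := univ)
    (mapsTo_univ _ _) ?_ finite_univ
  rintro e rfl e' (he' : Γ.src e' = Γ.src e) h
  obtain ⟨u, rfl⟩ := AddAction.orbitRel_apply.1 (Quotient.exact h)
  change Γ.src e' = Γ.src (u +ᵥ e') at he'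
  rw [hΓ.src_vadd] at he'
  simp [hΓ.free_vertices _ _ he'.symm]

theorem finite_setOf_dist_le (hΓ : Γ.IsPeriodic L n) (x : V) (i : ℕ) :
    {y | Γ.dist x y ≤ i}.Finite :=
  Γ.finite_setOf_dist_le hΓ.finite_setOf_src_eq x i

theorem finite_edgeLabels (hΓ : Γ.IsPeriodic L n) (a b : V) : (Γ.edgeLabels L a b).Finite := by
  have hsub (e : E) : {g : ℕ × L | Γ.tgt e = g.2 +ᵥ b ∧ Γ.weight e = g.1}.Subsingleton :=
    fun g hg h hh => Prod.ext (hg.2.symm.trans hh.2)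
      (hΓ.vadd_left_injective b (hg.1.symm.trans hh.1))
  refine ((hΓ.finite_setOf_src_eq a).biUnion fun e _ => (hsub e).finite).subset ?_
  rintro g ⟨e, he, hg⟩
  exact mem_biUnion he hg

theorem mk_mem_edgeLabels (hΓ : Γ.IsPeriodic L n) {e : E} {a b : V} {u v : L}
    (hsrc : Γ.src e = u +ᵥ a) (htgt : Γ.tgt e = v +ᵥ b) :
    (Γ.weight e, v - u) ∈ Γ.edgeLabels L a b := by
  refine ⟨-u +ᵥ e, ?_, ?_, hΓ.weight_vadd _ _⟩
  · rw [hΓ.src_vadd, hsrc, neg_vadd_vadd]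
  · rw [hΓ.tgt_vadd, htgt, vadd_vadd, neg_add_eq_sub]

theorem labelPath_of_isWalk (hΓ : Γ.IsPeriodic L n) {S : Set V}
    (hS : ∀ x, ∃ c ∈ S, x ∈ AddAction.orbit L c) {a b : V} {u v : L} {p : List E} (hp₀ : p ≠ [])
    (hp : Γ.IsWalk (u +ᵥ a) p (v +ᵥ b)) :
    LabelPath (Γ.edgeLabels L) S a b (Γ.walkWeight p, v - u) := by
  induction p generalizing a u with
  | nil => exact absurd rfl hp₀
  | cons e p ih =>
    obtain ⟨hsrc, hp⟩ := hp
    rcases eq_or_ne p [] with rfl | hp₀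
    · exact .single (by simpa [walkWeight] using hΓ.mk_mem_edgeLabels hsrc hp)
    · obtain ⟨c, hc, w, hw : w +ᵥ c = Γ.tgt e⟩ := hS (Γ.tgt e)
      have h := LabelPath.cons (hΓ.mk_mem_edgeLabels hsrc hw.symm) hc (ih hp₀ (hw.symm ▸ hp))
      rwa [Prod.mk_add_mk, ← walkWeight_cons, sub_add_sub_cancel'] at h

theorem exists_isWalk_of_labelPath (hΓ : Γ.IsPeriodic L n) {S : Set V} {a b : V} {g : ℕ × L}
    (h : LabelPath (Γ.edgeLabels L) S a b g) (u : L) :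
    ∃ p, Γ.IsWalk (u +ᵥ a) p ((u + g.2) +ᵥ b) ∧ Γ.walkWeight p = g.1 := by
  induction h generalizing u with
  | single hg =>
    obtain ⟨e, rfl, htgt, hw⟩ := hg
    refine ⟨[u +ᵥ e], ⟨hΓ.src_vadd u e, ?_⟩, by simp [walkWeight, hΓ.weight_vadd, hw]⟩
    rw [hΓ.tgt_vadd, htgt, vadd_vadd]
    rfl
  | @cons a c b g h hg _ _ ih =>
    obtain ⟨e, rfl, htgt, hw⟩ := hg
    obtain ⟨p, hp, hpw⟩ := ih (u + g.2)
    refine ⟨(u +ᵥ e) :: p, ⟨hΓ.src_vadd u e, ?_⟩, ?_⟩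
    · rwa [hΓ.tgt_vadd, htgt, vadd_vadd, Prod.snd_add, ← add_assoc]
    · rw [walkWeight_cons, hΓ.weight_vadd, hw, hpw, Prod.fst_add]

theorem isSemilinearSet_isWalk (hΓ : Γ.IsPeriodic L n) (a b : V) :
    IsSemilinearSet {g : ℕ × L | ∃ p, Γ.IsWalk a p (g.2 +ᵥ b) ∧ Γ.walkWeight p = g.1} := by
  have := hΓ.finite_vertices
  let S : Set V := range (Quotient.out : AddAction.orbitRel.Quotient L V → V)
  have hS (x : V) : ∃ c ∈ S, x ∈ AddAction.orbit L c :=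
    ⟨_, mem_range_self (Quotient.mk _ x),
      AddAction.orbitRel_apply.1 (Setoid.symm' _ (Quotient.mk_out x))⟩
  have hpaths : IsSemilinearSet {g | LabelPath (Γ.edgeLabels L) S a b g} :=
    LabelPath.isSemilinearSet (finite_range _)
      (fun c d => .of_finite (hΓ.finite_edgeLabels c d)) a b
  have htrivial : {g : ℕ × L | g.1 = 0 ∧ a = g.2 +ᵥ b}.Subsingleton := fun g hg h hh =>
    Prod.ext (hg.1.trans hh.1.symm) (hΓ.vadd_left_injective b (hg.2.symm.trans hh.2))
  convert hpaths.union (.of_finite htrivial.finite)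
  ext ⟨i, u⟩
  constructor
  · rintro ⟨p, hp, rfl : Γ.walkWeight p = i⟩
    rcases eq_or_ne p [] with rfl | hp₀
    · exact Or.inr ⟨rfl, hp⟩
    · rw [← zero_vadd L a] at hp
      exact Or.inl (sub_zero u ▸ hΓ.labelPath_of_isWalk hS hp₀ hp)
  · rintro (h | ⟨hi, hu⟩)
    · simpa using hΓ.exists_isWalk_of_labelPath h 0
    · exact ⟨[], hu, hi.symm⟩

theorem isSemilinearSet_dist_le (hΓ : Γ.IsPeriodic L n) (a b : V) :
    IsSemilinearSet {g : ℕ × L | Γ.dist a (g.2 +ᵥ b) ≤ g.1} := by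
  convert (hΓ.isSemilinearSet_isWalk a b).add (.closure_of_finite (finite_singleton (1, 0)))
  ext ⟨i, u⟩
  simp only [mem_ofPred_eq, dist_le_iff, mem_add, SetLike.mem_coe,
    AddSubmonoid.mem_closure_singleton]
  constructor
  · rintro ⟨p, hp, hi⟩
    exact ⟨(Γ.walkWeight p, u), ⟨p, hp, rfl⟩, _, ⟨i - Γ.walkWeight p, rfl⟩, by simp [hi]⟩
  · rintro ⟨⟨j, v⟩, ⟨p, hp, rfl⟩, _, ⟨k, rfl⟩, hk⟩
    obtain ⟨rfl, rfl⟩ : Γ.walkWeight p + k = i ∧ v = u := by simpa using hk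
    exact ⟨p, hp, Nat.le_add_right _ _⟩

theorem hasQuasiPolyCount_orbit (hΓ : Γ.IsPeriodic L n) (x₀ : V) (L' : AddSubgroup L) (x : V) :
    HasQuasiPolyCount Prod.fst {g : ℕ × V | g.2 ∈ AddAction.orbit L' x ∧ Γ.dist x₀ g.2 ≤ g.1} := by
  have := hΓ.isAddTorsionFree
  have : AddMonoid.FG L' := (AddMonoid.fg_iff_addSubmonoid_fg _).2
    ((AddSubgroup.fg_iff_addSubmonoid_fg _).1 (hΓ.fg_addSubgroup L'))
  let s : Set (ℕ × L') := {g | Γ.dist x₀ (g.2 +ᵥ x) ≤ g.1}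
  let f : ℕ × L' → ℕ × V := Prod.map id (· +ᵥ x)
  have hs : IsSemilinearSet s := (hΓ.isSemilinearSet_dist_le x₀ x).preimage
    ((AddMonoidHom.id ℕ).prodMap L'.subtype)
  have hf : Function.Injective f := Function.injective_id.prodMap
    ((hΓ.vadd_left_injective x).comp Subtype.val_injective)
  have hfin (i : ℕ) : (s ∩ AddMonoidHom.fst ℕ L' ⁻¹' {i}).Finite := by
    refine Set.Finite.of_injOn (f := f) ?_ hf.injOn
      ((finite_singleton i).prod (hΓ.finite_setOf_dist_le x₀ i))
    rintro g ⟨hg, rfl⟩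
    exact ⟨rfl, hg⟩
  convert (hasQuasiPolyCount_of_isSemilinearSet hs hfin).image (v := Prod.fst) (a := 0) hf.injOn
    fun g _ => rfl
  ext ⟨i, y⟩
  constructor
  · rintro ⟨⟨u, rfl⟩, hu⟩
    exact ⟨(i, u), hu, rfl⟩
  · rintro ⟨⟨j, u⟩, hu, ⟨⟩⟩
    exact ⟨⟨u, rfl⟩, hu⟩

theorem hasQuasiPolyCount (hΓ : Γ.IsPeriodic L n) (x₀ : V) (L' : AddSubgroup L)
    (V' : SubAddAction L' V) (hV' : V'.FG) :
    HasQuasiPolyCount Prod.fst {g : ℕ × V | g.2 ∈ V' ∧ Γ.dist x₀ g.2 ≤ g.1} := by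
  obtain ⟨F, hF, rfl⟩ := hV'
  let π : V → AddAction.orbitRel.Quotient L' V := Quotient.mk _
  have hunion : {g : ℕ × V | g.2 ∈ SubAddAction.closure L' F ∧ Γ.dist x₀ g.2 ≤ g.1} =
      ⋃ q ∈ π '' F, {g : ℕ × V | g.2 ∈ q.orbit ∧ Γ.dist x₀ g.2 ≤ g.1} := by
    ext g
    simp [π, mem_subAddAction_closure_iff, ← Quotient.mk''_eq_mk, ← exists_and_right, and_assoc,
      and_left_comm]
  rw [hunion]
  refine .biUnion_of_pairwiseDisjoint (hF.image π) ?_ ?_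
  · rintro _ ⟨x, -, rfl⟩
    exact hΓ.hasQuasiPolyCount_orbit x₀ L' x
  · refine fun q _ r _ hqr => Set.disjoint_left.2 fun g hq hr => hqr ?_
    exact (AddAction.orbitRel.Quotient.mem_orbit.1 hq.1).symm.trans
      (AddAction.orbitRel.Quotient.mem_orbit.1 hr.1)

end IsPeriodic

end WeightedDigraph

theorem theoremA4 {V E L : Type*} [AddCommGroup L] [AddAction L V] [AddAction L E]
    (Γ : WeightedDigraph V E) (n : ℕ) (hΓ : Γ.IsPeriodic L n) (x₀ : V)
    (L' : AddSubgroup L) (V' : SubAddAction L' V) (hV' : V'.FG) :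
    (∀ i : ℕ, {y : V | y ∈ V' ∧ Γ.dist x₀ y ≤ (i : ℕ∞)}.Finite) ∧
      IsOfQuasiPolynomialType
        (fun i : ℕ => (Set.ncard {y : V | y ∈ V' ∧ Γ.dist x₀ y ≤ (i : ℕ∞)} : ℂ)) := by
  refine ⟨fun i => (hΓ.finite_setOf_dist_le x₀ i).subset fun y hy => hy.2, ?_⟩
  have hfiber (i : ℕ) : {g : ℕ × V | g.2 ∈ V' ∧ Γ.dist x₀ g.2 ≤ g.1} ∩ Prod.fst ⁻¹' {i} =
      Prod.mk i '' {y | y ∈ V' ∧ Γ.dist x₀ y ≤ i} := by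
    ext ⟨j, y⟩
    constructor
    · rintro ⟨h, rfl⟩
      exact ⟨y, h, rfl⟩
    · rintro ⟨y, h, ⟨⟩⟩
      exact ⟨h, rfl⟩
  have hcount := (hΓ.hasQuasiPolyCount x₀ L' V' hV').ncard_mem
  simp only [hfiber, (Prod.mk_right_injective _).injOn.ncard_image] at hcount
  exact isOfQuasiPolynomialType_of_mem_quasiPolySeq hcount
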